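/- Let $d\ge 2$, let $L(\mathbb C^d)$ be the algebra of linear endomorphisms of $\mathbb C^d$, $I$ its identity channel, and put $m_1=-\frac1{d-1}$, $m_2=-\frac1{d^2-1}$. A meter is a finite-outcome positive operator valued measure, a channel is a completely positive linear map sending states to trace-one operators (Schrödinger picture), and an instrument is a finite family $\mathcal J=(\mathcal J(x,\cdot))_x$ of completely positive linear maps whose sum is a channel; $\Phi^\dagger$ is defined by $\mathrm{tr}(\rho\,\Phi^\dagger(A))=\mathrm{tr}(\Phi(\rho)A)$. The sharp meter of an orthonormal basis $\varphi=(\varphi_x)_{x}$ of $\mathbb C^d$ is $Q(x)=|\varphi_x\rangle\langle\varphi_x|$. For real $s,t,r$ set $Q_s(x)=s\,Q(x)+(1-s)\frac1d\mathbb 1$, and likewise $P_t$ for a sharp meter $P$, and $I_r(A)=rA+(1-r)\frac1d\,\mathrm{tr}(A)\,\mathbb 1$. Channels $\Phi_1,\Phi_2$ on $L(\mathbb C^d)$ are compatible if there is a channel $\Gamma:L(\mathbb C^d)\to L(\mathbb C^d\otimes\mathbb C^d)$ with $\mathrm{tr}_2\circ\Gamma=\Phi_1$ and $\mathrm{tr}_1\circ\Gamma=\Phi_2$.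 A meter $M$ and a channel $\Phi$ are compatible if there is an instrument $\mathcal J$ with $\mathcal J^\dagger(x,\mathbb 1)=M(x)$ for all $x$ and $\sum_x\mathcal J(x,\cdot)=\Phi$. A meter $G$ on $X\times Y$ is a joint meter of $M$ and $N$ if $\sum_yG(x,y)=M(x)$ and $\sum_xG(x,y)=N(y)$ for all $x,y$. Define the extended compatibility regions $$\mathrm{ECR}(I,I)=\{(s,t)\in[m_2,1]^2: I_s,\ I_t\text{ compatible}\},\qquad \mathrm{ECR}(Q,I)=\{(s,t)\in[m_1,1]\times[m_2,1]: Q_s,\ I_t\text{ compatible}\}.$$ Let $\mathcal C_d$ be the set of real pairs $(s,t)$ achievable by cloning, i.e. such that for some channel $\Gamma:L(\mathbb C^d)\to L(\mathbb C^d\otimes\mathbb C^d)$ the map $(x,y)\mapsto\Gamma^\dagger(Q'(x)\otimes P(y))$ is a joint meter of $Q'_s$ and $P_t$ for all sharp meters $Q',P$. Let $\mathcal S_Q$ be the set of real pairs $(s,t)$ achievable by sequential measurements with $Q$ fixed, i.e. such that for some instrument $\mathcal J$ on $L(\mathbb C^d)$ the map $(x,y)\mapsto\mathcal J^\dagger(x,P(y))$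 is a joint meter of $Q_s$ and $P_t$ for all sharp meters $P$. Then for every $d\ge2$ and every sharp meter $Q$ on $\mathbb C^d$: 1. $\mathrm{ECR}(I,I)\subsetneq\mathrm{ECR}(Q,I)$; 2. $\mathcal C_d\subsetneq\mathcal S_Q$, that is, when negative noise parameters are allowed, sequential measurements optimized for $Q$ have an advantage over cloning; 3. for every $s\in[m_2,0)$ there is $t\in(0,1)$ such that $Q_s$ and $I_t$ are compatible while $I_s$ and $I_t$ are not, and also $(s,t)\in\mathcal S_Q\setminus\mathcal C_d$. -/

import Mathlib

open scoped Matrix Kronecker MatrixOrder Matrix.Norms.L2Operator ComplexOrder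

namespace QuantumDevices

/-- The algebra `L(ℂⁿ)` of linear endomorphisms of the Hilbert space `ℂⁿ`, for a finite index set
`n`, written as matrices; `L(ℂᵈ ⊗ ℂᵈ)` is `Op (Fin d × Fin d)`. Its order is the Loewner order
(`0 ≤ A` means that `A` is positive semidefinite). -/
abbrev Op (n : Type) : Type := Matrix n n ℂ

section Devices

variable {n m X Y : Type} [Fintype n] [DecidableEq n] [Fintype m] [DecidableEq m]
  [Fintype X] [Fintype Y]

/-- States (density operators). -/
def IsState (ρ : Op n) : Prop := 0 ≤ ρ ∧ ρ.trace = 1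

/-- Meters (positive operator valued measures) with outcomes in the finite set `X`. -/
def IsMeter (M : X → Op n) : Prop := (∀ x, 0 ≤ M x) ∧ ∑ x, M x = 1

/-- Complete positivity of a linear map between matrix algebras. -/
def IsCP (Φ : Op n →ₗ[ℂ] Op m) : Prop :=
  ∃ F : CompletelyPositiveMap (Op n) (Op m), F.toLinearMap = Φ

/-- Channels, in the Schrödinger picture. -/
def IsChannel (Φ : Op n →ₗ[ℂ] Op m) : Prop :=
  IsCP Φ ∧ ∀ ρ : Op n, IsState ρ → (Φ ρ).trace = 1

/-- Instruments, in the Schrödinger picture. -/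
def IsInstrument (J : X → Op n →ₗ[ℂ] Op m) : Prop :=
  (∀ x, IsCP (J x)) ∧ IsChannel (∑ x, J x)

/-- The Heisenberg picture `Φ†` of a linear map `Φ`, that is, the linear map determined by
`tr (ρ Φ†(A)) = tr (Φ(ρ) A)` (see `trace_mul_heisenberg`). -/
def heisenberg (Φ : Op n →ₗ[ℂ] Op m) : Op m →ₗ[ℂ] Op n where
  toFun A := Matrix.of fun i j => (Φ (Matrix.single j i 1) * A).trace
  map_add' A B := by ext i j; simp [mul_add]
  map_smul' c A := by ext i j; simp

theorem trace_mul_heisenberg (Φ : Op n →ₗ[ℂ] Op m) (ρ : Op n) (A : Op m) :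
    (ρ * heisenberg Φ A).trace = (Φ ρ * A).trace := by
  have key : ∀ i j (c : ℂ), (Matrix.single i j c * heisenberg Φ A).trace
      = (Φ (Matrix.single i j c) * A).trace := by
    intro i j c
    have hc : (Matrix.single i j c : Op n) = c • Matrix.single i j 1 := by simp
    rw [hc, map_smul]
    simp [Matrix.trace_single_mul, heisenberg]
  induction ρ using Matrix.induction_on' with
  | h_zero => simp
  | h_add p q hp hq => simp only [add_mul, map_add, Matrix.trace_add, hp, hq]
  | h_std_basis i j c => exact key i j c

/-- `G` is a joint meter for `M` and `N`. -/
def IsJointMeter (G : X × Y → Op n) (M : X → Op n) (N : Y → Op n) : Prop :=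
  IsMeter G ∧ (∀ x, ∑ y, G (x, y) = M x) ∧ ∀ y, ∑ x, G (x, y) = N y

/-- Partial trace over the first factor of a tensor product. -/
def partialTrace₁ : Op (n × m) →ₗ[ℂ] Op m where
  toFun A := Matrix.of fun i j => ∑ k, A (k, i) (k, j)
  map_add' A B := by ext i j; simp [Finset.sum_add_distrib]
  map_smul' c A := by ext i j; simp [Finset.mul_sum]

/-- Partial trace over the second factor of a tensor product. -/
def partialTrace₂ : Op (n × m) →ₗ[ℂ] Op n where
  toFun A := Matrix.of fun i j => ∑ k, A (i, k) (j, k)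
  map_add' A B := by ext i j; simp [Finset.sum_add_distrib]
  map_smul' c A := by ext i j; simp [Finset.mul_sum]

/-- Two channels (or linear maps) `Φ₁`, `Φ₂` are compatible if they admit a joint channel `Γ`:
the two marginals of `Γ` are `Φ₁` and `Φ₂`. -/
def CompatibleChannels (Φ₁ Φ₂ : Op n →ₗ[ℂ] Op n) : Prop :=
  ∃ Γ : Op n →ₗ[ℂ] Op (n × n), IsChannel Γ ∧
    partialTrace₂ ∘ₗ Γ = Φ₁ ∧ partialTrace₁ ∘ₗ Γ = Φ₂

/-- A meter `M` and a channel `Φ` are compatible if they admit a joint instrument `J`. -/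
def CompatibleMeterChannel (M : X → Op n) (Φ : Op n →ₗ[ℂ] Op n) : Prop :=
  ∃ J : X → Op n →ₗ[ℂ] Op n, IsInstrument J ∧
    (∀ x, heisenberg (J x) 1 = M x) ∧ ∑ x, J x = Φ

/-- The meter obtained by applying `Γ` and then measuring `M` on the first output and `N` on the
second one. -/
def cloningMeter (Γ : Op n →ₗ[ℂ] Op (n × n)) (M : X → Op n) (N : Y → Op n) : X × Y → Op n :=
  fun p => heisenberg Γ (M p.1 ⊗ₖ N p.2)

/-- The meter obtained by performing the instrument `J` and then measuring `N`. -/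
def sequentialMeter (J : X → Op n →ₗ[ℂ] Op n) (N : Y → Op n) : X × Y → Op n :=
  fun p => heisenberg (J p.1) (N p.2)

end Devices

section Noise

variable {d : ℕ}

/-- Orthonormal bases of the Hilbert space `ℂᵈ`. -/
abbrev ONB (d : ℕ) : Type := OrthonormalBasis (Fin d) ℂ (EuclideanSpace ℂ (Fin d))

/-- The sharp meter `Q(x) = |φₓ⟩⟨φₓ|` of an orthonormal basis `φ`. -/
noncomputable def sharpMeter (φ : ONB d) (x : Fin d) : Op (Fin d) :=
  Matrix.vecMulVec (φ x).ofLp (star (φ x).ofLp)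

/-- The noisy version `Q_s(x) = s |φₓ⟩⟨φₓ| + (1 - s) (1/d) 𝟙` of the sharp meter of `φ`. -/
noncomputable def noisyMeter (φ : ONB d) (s : ℝ) (x : Fin d) : Op (Fin d) :=
  (s : ℂ) • sharpMeter φ x + (((1 - s) / d : ℝ) : ℂ) • (1 : Op (Fin d))

/-- The depolarizing map `I_r(A) = r A + (1 - r) (1/d) tr(A) 𝟙` on `L(ℂᵈ)`. -/
noncomputable def depolarizing (d : ℕ) (r : ℝ) : Op (Fin d) →ₗ[ℂ] Op (Fin d) :=
  (r : ℂ) • LinearMap.id + (((1 - r) / d : ℝ) : ℂ) •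
    (Matrix.traceLinearMap (Fin d) ℂ ℂ).smulRight (1 : Op (Fin d))

/-- `m₁ = -1/(d - 1)`, the least noise parameter of noisy sharp meters. -/
noncomputable def m₁ (d : ℕ) : ℝ := -1 / ((d : ℝ) - 1)

/-- `m₂ = -1/(d² - 1)`, the least noise parameter of depolarizing channels. -/
noncomputable def m₂ (d : ℕ) : ℝ := -1 / ((d : ℝ) ^ 2 - 1)

/-- The extended compatibility region of the pair `(I, I)` in dimension `d`. -/
def ecrII (d : ℕ) : Set (ℝ × ℝ) :=
  {p | p.1 ∈ Set.Icc (m₂ d) 1 ∧ p.2 ∈ Set.Icc (m₂ d) 1 ∧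
    CompatibleChannels (depolarizing d p.1) (depolarizing d p.2)}

/-- The extended compatibility region of the pair `(Q, I)`, with `Q` the sharp meter of `φ`. -/
def ecrQI (φ : ONB d) : Set (ℝ × ℝ) :=
  {p | p.1 ∈ Set.Icc (m₁ d) 1 ∧ p.2 ∈ Set.Icc (m₂ d) 1 ∧
    CompatibleMeterChannel (noisyMeter φ p.1) (depolarizing d p.2)}

/-- The noise parameters `(s, t)` achieved by cloning: a single channel `Γ` yields a joint meter of
`Q_s` and `P_t` for all pairs `(Q, P)` of sharp meters. -/
def cloningTradeoff (d : ℕ) : Set (ℝ × ℝ) :=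
  {p | ∃ Γ : Op (Fin d) →ₗ[ℂ] Op (Fin d × Fin d), IsChannel Γ ∧ ∀ φ ψ : ONB d,
    IsJointMeter (cloningMeter Γ (sharpMeter φ) (sharpMeter ψ))
      (noisyMeter φ p.1) (noisyMeter ψ p.2)}

/-- The noise parameters `(s, t)` achieved by sequential measurements with the first sharp meter `Q`
fixed (the one of `φ`): a single instrument `J`, chosen for `Q`, yields a joint meter of `Q_s` and
`P_t` for all sharp meters `P`. -/
def sequentialTradeoff (φ : ONB d) : Set (ℝ × ℝ) :=
  {p | ∃ J : Fin d → Op (Fin d) →ₗ[ℂ] Op (Fin d), IsInstrument J ∧ ∀ ψ : ONB d,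
    IsJointMeter (sequentialMeter J (sharpMeter ψ)) (noisyMeter φ p.1) (noisyMeter ψ p.2)}

end Noise

end QuantumDevices

/-! Sharp effects determine a linear map on `Op (Fin d)`, so a channel that clones with parameters
`(s, t)` is exactly a joint channel of `I_s` and `I_t` (`mem_cloningTradeoff_iff`). Measuring `Q` on
the first clone turns it into a joint instrument of `Q_s` and `I_t`
(`compatible_of_compatibleChannels`), and a joint instrument yields a sequential scheme. This gives
both inclusions; strictness follows from the advantage at one negative `s`.

For the advantage, an instrument built on the Kraus operators `a 𝟙 - b Q(x)` suppresses the outcome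
`x` coherently and realizes `s = -2ab`, `t = 1 - d b²` (`compatible_of_coherent_exclusion`).
Cloning, on the other hand, obeys a family of linear inequalities in `(s, t)` indexed by `c > 0`
(`CompatibleChannels.tradeoff`): the two marginal fidelities are squared overlaps of the Kraus
vectors with two families of nonorthogonal vectors, and projecting onto their span bounds them
jointly. A suitable `c` shows that the instrument's pair violates this bound (`exists_advantage`).
-/

namespace QuantumDevices

/-! ### Complete positivity and Kraus decompositions -/

section Kraus

variable {n m l : Type} [Fintype n] [DecidableEq n] [Fintype m] [DecidableEq m]
  [Fintype l] [DecidableEq l]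

/-- `Φ` has a Kraus decomposition `Φ(ρ) = ∑ₑ Vₑ ρ Vₑ†`. -/
def HasKraus (Φ : Op n →ₗ[ℂ] Op m) : Prop :=
  ∃ (ι : Type) (_ : Fintype ι) (V : ι → Matrix m n ℂ), ∀ ρ, Φ ρ = ∑ e, V e * ρ * (V e)ᴴ

/-- Each rank-one Gram term is written as `star C * C`, where `C` repeats the vector `w e` in every
row. -/
theorem cstarMatrix_nonneg_of_gram {k : Type} [Fintype k] {ι : Type} [Fintype ι]
    (M : CStarMatrix k k (Op m)) (w : ι → k → m → ℂ)
    (hM : ∀ i j p q, M i j p q = ∑ e, star (w e i p) * w e j q) : 0 ≤ M := by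
  classical
  -- Compensates for the `card k * card m` identical rows that the product sums over.
  let c : ℝ := ((Fintype.card k : ℝ) * Fintype.card m)⁻¹
  let C : ι → CStarMatrix k k (Op m) := fun e =>
    CStarMatrix.ofMatrix fun _ j => Matrix.of fun _ q => ((Real.sqrt c : ℝ) : ℂ) * w e j q
  have h : M = ∑ e, star (C e) * C e := by
    refine CStarMatrix.ext fun i j => ?_
    have hsum : (∑ e, star (C e) * C e) i j = ∑ e, (star (C e) * C e) i j := by
      induction (Finset.univ : Finset ι) using Finset.induction_on with
      | empty => simp
      | insert a s ha ih => rw [Finset.sum_insert ha, Finset.sum_insert ha, ← ih]; rfl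
    rw [hsum]
    ext p q
    rw [hM, Matrix.sum_apply]
    refine Finset.sum_congr rfl fun e _ => ?_
    have hk : (Fintype.card k : ℂ) ≠ 0 := by
      have : Nonempty k := ⟨i⟩
      exact_mod_cast Fintype.card_ne_zero
    have hm : (Fintype.card m : ℂ) ≠ 0 := by
      have : Nonempty m := ⟨p⟩
      exact_mod_cast Fintype.card_ne_zero
    have hc : ((Real.sqrt c : ℝ) : ℂ) * ((Real.sqrt c : ℝ) : ℂ)
        = ((Fintype.card k : ℂ) * Fintype.card m)⁻¹ := by
      rw [← Complex.ofReal_mul, Real.mul_self_sqrt (by positivity)]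
      simp [c]
    rw [CStarMatrix.mul_apply, Matrix.sum_apply]
    have hC : ∀ l j r q, C e l j r q = ((Real.sqrt c : ℝ) : ℂ) * w e j q := fun _ _ _ _ => rfl
    simp only [CStarMatrix.star_apply, Matrix.mul_apply, Matrix.star_apply, hC, Finset.sum_const,
      Finset.card_univ, nsmul_eq_mul, star_mul', Complex.star_def, Complex.conj_ofReal]
    calc _ = ((Fintype.card k : ℂ) * Fintype.card m) * ((Fintype.card k : ℂ) * Fintype.card m)⁻¹ *
          ((starRingEnd ℂ) (w e i p) * w e j q) := by
            rw [mul_inv_cancel₀ (mul_ne_zero hk hm), one_mul]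
      _ = _ := by rw [← hc]; ring
  rw [h]
  exact Finset.sum_nonneg fun e _ => star_mul_self_nonneg (C e)

theorem exists_gram_of_cstarMatrix_nonneg {k : Type} [Fintype k]
    (M : CStarMatrix k k (Op m)) (hM : 0 ≤ M) :
    ∃ (ι : Type) (_ : Fintype ι) (w : ι → k → m → ℂ),
      ∀ i j p q, M i j p q = ∑ e, star (w e i p) * w e j q := by
  rw [StarOrderedRing.nonneg_iff] at hM
  induction hM using AddSubmonoid.closure_induction with
  | mem _ h =>
    obtain ⟨B, rfl⟩ := h
    refine ⟨k × m, inferInstance, fun e i p => B e.1 i e.2 p, fun i j p q => ?_⟩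
    change (star B * B) i j p q = _
    rw [CStarMatrix.mul_apply, Matrix.sum_apply, Fintype.sum_prod_type]
    simp [CStarMatrix.star_apply, Matrix.mul_apply]
  | zero => exact ⟨Empty, inferInstance, fun _ _ _ => 0, fun i j p q => by simp⟩
  | add A B _ _ hA hB =>
    obtain ⟨ι, _, v, hv⟩ := hA
    obtain ⟨κ, _, w, hw⟩ := hB
    refine ⟨ι ⊕ κ, inferInstance, Sum.elim v w, fun i j p q => ?_⟩
    rw [CStarMatrix.add_apply, Matrix.add_apply, hv, hw]
    simp

theorem IsCP.of_hasKraus {Φ : Op n →ₗ[ℂ] Op m} (h : HasKraus Φ) : IsCP Φ := by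
  obtain ⟨ι, _, V, hV⟩ := h
  refine ⟨⟨Φ, fun k M hM => ?_⟩, rfl⟩
  obtain ⟨κ, _, w, hw⟩ := exists_gram_of_cstarMatrix_nonneg M hM
  refine cstarMatrix_nonneg_of_gram _
    (fun (e : ι × κ) i p => ∑ a, w e.2 i a * star (V e.1 p a)) fun i j p q => ?_
  rw [CStarMatrix.map_apply]
  change Φ (M i j) p q = _
  rw [hV, Matrix.sum_apply, Fintype.sum_prod_type]
  refine Finset.sum_congr rfl fun e _ => ?_
  simp only [Matrix.mul_apply, Matrix.conjTranspose_apply, hw, star_sum, star_mul', star_star,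
    Finset.sum_mul, Finset.mul_sum]
  calc _ = ∑ b, ∑ c, ∑ a, V e p a * (star (w c i a) * w c j b) * star (V e q b) :=
        Finset.sum_congr rfl fun b _ => Finset.sum_comm
    _ = _ := by
        rw [Finset.sum_comm]
        refine Finset.sum_congr rfl fun c _ => Finset.sum_congr rfl fun b _ =>
          Finset.sum_congr rfl fun a _ => ?_
        ring

/-- Choi's argument: the block matrix of matrix units is positive, hence so is its image under `Φ`,
and the Gram vectors of that image are the conjugated entries of the Kraus operators. -/
theorem IsCP.hasKraus {Φ : Op n →ₗ[ℂ] Op m} (h : IsCP Φ) : HasKraus Φ := by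
  obtain ⟨F, rfl⟩ := h
  let M : CStarMatrix n n (Op n) := CStarMatrix.ofMatrix fun i j => Matrix.single i j 1
  have hM : 0 ≤ M := by
    refine cstarMatrix_nonneg_of_gram (ι := Unit) M (fun _ i p => if i = p then 1 else 0)
      fun i j p q => ?_
    have h : M i j p q = Matrix.single i j 1 p q := rfl
    rw [h, Matrix.single_apply]
    split_ifs <;> simp_all
  obtain ⟨κ, _, w, hw⟩ := exists_gram_of_cstarMatrix_nonneg _ (F.map_cstarMatrix_nonneg M hM)
  refine ⟨κ, inferInstance, fun e => Matrix.of fun p i => star (w e i p), fun ρ => ?_⟩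
  have key : ∀ i j (c : ℂ), F.toLinearMap (Matrix.single i j c) = ∑ e,
      (Matrix.of fun p i => star (w e i p)) * Matrix.single i j c *
        (Matrix.of fun p i => star (w e i p))ᴴ := by
    intro i j c
    have hc : (Matrix.single i j c : Op n) = c • Matrix.single i j 1 := by simp
    ext p q
    have h1 : F.toLinearMap (Matrix.single i j 1) p q = ∑ e, star (w e i p) * w e j q := hw i j p q
    rw [hc, map_smul, Matrix.smul_apply, h1, Matrix.sum_apply, smul_eq_mul, Finset.mul_sum]
    refine Finset.sum_congr rfl fun e _ => ?_
    simp [Matrix.mul_apply, Matrix.single_apply, ite_and]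
    ring
  induction ρ using Matrix.induction_on' with
  | h_zero => simp
  | h_add p q hp hq =>
    simp only [map_add, hp, hq, Matrix.mul_add, Matrix.add_mul, Finset.sum_add_distrib]
  | h_std_basis i j c => exact key i j c

theorem isCP_zero : IsCP (0 : Op n →ₗ[ℂ] Op m) :=
  .of_hasKraus ⟨Empty, inferInstance, fun _ => 0, fun ρ => by simp⟩

theorem IsCP.add {Φ Ψ : Op n →ₗ[ℂ] Op m} (hΦ : IsCP Φ) (hΨ : IsCP Ψ) : IsCP (Φ + Ψ) := by
  obtain ⟨ι, _, V, hV⟩ := hΦ.hasKraus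
  obtain ⟨κ, _, W, hW⟩ := hΨ.hasKraus
  exact .of_hasKraus ⟨ι ⊕ κ, inferInstance, Sum.elim V W, fun ρ => by simp [hV, hW]⟩

theorem IsCP.sum {ι : Type} (s : Finset ι) {Φ : ι → Op n →ₗ[ℂ] Op m} (h : ∀ i ∈ s, IsCP (Φ i)) :
    IsCP (∑ i ∈ s, Φ i) :=
  Finset.sum_induction _ _ (fun _ _ => IsCP.add) isCP_zero h

theorem IsCP.smul {Φ : Op n →ₗ[ℂ] Op m} (hΦ : IsCP Φ) {c : ℝ} (hc : 0 ≤ c) :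
    IsCP ((c : ℂ) • Φ) := by
  obtain ⟨ι, _, V, hV⟩ := hΦ.hasKraus
  refine .of_hasKraus ⟨ι, inferInstance, fun e => ((Real.sqrt c : ℝ) : ℂ) • V e, fun ρ => ?_⟩
  rw [LinearMap.smul_apply, hV, Finset.smul_sum]
  refine Finset.sum_congr rfl fun e _ => ?_
  rw [Matrix.conjTranspose_smul, Matrix.smul_mul, Matrix.smul_mul, Matrix.mul_smul, smul_smul,
    Complex.star_def, Complex.conj_ofReal, ← Complex.ofReal_mul, Real.mul_self_sqrt hc]

theorem IsCP.comp {Ψ : Op m →ₗ[ℂ] Op l} {Φ : Op n →ₗ[ℂ] Op m} (hΨ : IsCP Ψ) (hΦ : IsCP Φ) :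
    IsCP (Ψ ∘ₗ Φ) := by
  obtain ⟨ι, _, V, hV⟩ := hΦ.hasKraus
  obtain ⟨κ, _, W, hW⟩ := hΨ.hasKraus
  refine .of_hasKraus ⟨ι × κ, inferInstance, fun e => W e.2 * V e.1, fun ρ => ?_⟩
  rw [LinearMap.comp_apply, hV, map_sum, Fintype.sum_prod_type]
  simp [hW, Matrix.mul_assoc]

/-- The linear map `ρ ↦ V ρ V†`. -/
def conjMap (V : Matrix m n ℂ) : Op n →ₗ[ℂ] Op m where
  toFun ρ := V * ρ * Vᴴ
  map_add' A B := by simp [Matrix.mul_add, Matrix.add_mul]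
  map_smul' c A := by simp

omit [DecidableEq n] [Fintype m] [DecidableEq m] in
theorem conjMap_apply (V : Matrix m n ℂ) (ρ : Op n) : conjMap V ρ = V * ρ * Vᴴ := rfl

theorem isCP_conjMap (V : Matrix m n ℂ) : IsCP (conjMap V) :=
  .of_hasKraus ⟨Unit, inferInstance, fun _ => V, fun ρ => by simp [conjMap]⟩

theorem heisenberg_eq_of_forall_trace {Φ : Op n →ₗ[ℂ] Op m} {A : Op m} {B : Op n}
    (h : ∀ ρ, (Φ ρ * A).trace = (ρ * B).trace) : heisenberg Φ A = B := by
  rw [Matrix.ext_iff_trace_mul_left]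
  intro ρ
  rw [trace_mul_heisenberg, h]

theorem IsCP.heisenberg_nonneg {Φ : Op n →ₗ[ℂ] Op m} (hΦ : IsCP Φ) {A : Op m} (hA : 0 ≤ A) :
    0 ≤ heisenberg Φ A := by
  obtain ⟨ι, _, V, hV⟩ := hΦ.hasKraus
  have h : heisenberg Φ A = ∑ e, (V e)ᴴ * A * V e := by
    refine heisenberg_eq_of_forall_trace fun ρ => ?_
    rw [hV, Finset.sum_mul, Finset.mul_sum, Matrix.trace_sum, Matrix.trace_sum]
    refine Finset.sum_congr rfl fun e _ => ?_
    rw [Matrix.mul_assoc, Matrix.mul_assoc, Matrix.trace_mul_comm]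
    simp only [Matrix.mul_assoc]
  rw [h]
  refine Finset.sum_nonneg fun e _ => ?_
  rw [Matrix.nonneg_iff_posSemidef] at hA ⊢
  exact hA.conjTranspose_mul_mul_same _

end Kraus

/-! ### Sharp meters and depolarizing maps -/

section Sharp

variable {d : ℕ} (φ : ONB d)

theorem star_dotProduct_onb (x y : Fin d) :
    star (φ x).ofLp ⬝ᵥ (φ y).ofLp = if x = y then 1 else 0 := by
  have h := orthonormal_iff_ite.mp φ.orthonormal x y
  rw [← h, EuclideanSpace.inner_eq_star_dotProduct, dotProduct_comm]

theorem sharpMeter_sum : ∑ x, sharpMeter φ x = 1 := by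
  ext p q
  have h := φ.sum_inner_mul_inner (EuclideanSpace.single p 1) (EuclideanSpace.single q 1)
  simp only [EuclideanSpace.inner_single_left, EuclideanSpace.inner_single_right] at h
  rw [Matrix.sum_apply]
  simpa [sharpMeter, Matrix.vecMulVec_apply, Matrix.one_apply, eq_comm] using h

theorem vecMulVec_mul_mul_vecMulVec {n m : Type} [Fintype n] (a e : m → ℂ) (b c : n → ℂ)
    (ρ : Op n) : Matrix.vecMulVec a b * ρ * Matrix.vecMulVec c e
      = (Matrix.vecMulVec c b * ρ).trace • Matrix.vecMulVec a e := by
  have h : (Matrix.vecMulVec c b * ρ).trace = (b ᵥ* ρ) ⬝ᵥ c := by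
    rw [Matrix.vecMulVec_mul, Matrix.trace_vecMulVec, dotProduct_comm]
  rw [h, Matrix.vecMulVec_mul, Matrix.vecMulVec_mul_vecMulVec, Matrix.vecMulVec_smul]

theorem sharpMeter_conjTranspose (x : Fin d) : (sharpMeter φ x)ᴴ = sharpMeter φ x := by
  simp [sharpMeter, Matrix.conjTranspose_vecMulVec]

theorem sharpMeter_trace (x : Fin d) : (sharpMeter φ x).trace = 1 := by
  rw [sharpMeter, Matrix.trace_vecMulVec, dotProduct_comm, star_dotProduct_onb, if_pos rfl]

theorem sharpMeter_nonneg (x : Fin d) : 0 ≤ sharpMeter φ x := by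
  rw [Matrix.nonneg_iff_posSemidef]
  exact Matrix.posSemidef_vecMulVec_self_star _

theorem depolarizing_apply (r : ℝ) (A : Op (Fin d)) :
    depolarizing d r A = (r : ℂ) • A + (((1 - r) / d : ℝ) : ℂ) • A.trace • 1 := rfl

theorem depolarizing_sharpMeter (s : ℝ) (x : Fin d) :
    depolarizing d s (sharpMeter φ x) = noisyMeter φ s x := by
  rw [depolarizing_apply, sharpMeter_trace, one_smul, noisyMeter]

theorem heisenberg_depolarizing (r : ℝ) :
    heisenberg (depolarizing d r) = depolarizing d r := by
  refine LinearMap.ext fun A => heisenberg_eq_of_forall_trace fun ρ => ?_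
  simp only [depolarizing_apply, add_mul, mul_add, Matrix.trace_add, Matrix.smul_mul,
    Matrix.mul_smul, Matrix.trace_smul, one_mul, mul_one, smul_eq_mul]
  ring

/-- Every unit vector belongs to an orthonormal basis, so the maps agree on all `|v⟩⟨v|`;
polarization extends this to `|v⟩⟨w|`, in particular to matrix units. -/
theorem linearMap_ext_sharpMeter {M : Type} [AddCommGroup M] [Module ℂ M]
    {L L' : Op (Fin d) →ₗ[ℂ] M}
    (h : ∀ (ψ : ONB d) (x : Fin d), L (sharpMeter ψ x) = L' (sharpMeter ψ x)) : L = L' := by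
  rcases Nat.eq_zero_or_pos d with rfl | hd
  · exact LinearMap.ext fun A => by rw [Subsingleton.elim A 0, map_zero, map_zero]
  let x₀ : Fin d := ⟨0, hd⟩
  have hunit : ∀ v : EuclideanSpace ℂ (Fin d), ‖v‖ = 1 →
      L (Matrix.vecMulVec v.ofLp (star v.ofLp)) = L' (Matrix.vecMulVec v.ofLp (star v.ofLp)) := by
    intro v hv
    have hon : Orthonormal ℂ (Set.domRestrict {x₀} fun _ : Fin d => v) := by
      rw [orthonormal_iff_ite]
      rintro ⟨i, hi⟩ ⟨j, hj⟩
      have hij : i = j := (show i = x₀ from hi).trans (show j = x₀ from hj).symm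
      subst hij
      simp [inner_self_eq_norm_sq_to_K, hv]
    obtain ⟨ψ, hψ⟩ := hon.exists_orthonormalBasis_extension_of_card_eq (by simp)
    have := h ψ x₀
    rwa [sharpMeter, hψ x₀ rfl] at this
  have hall : ∀ v : Fin d → ℂ,
      L (Matrix.vecMulVec v (star v)) = L' (Matrix.vecMulVec v (star v)) := by
    intro v
    by_cases hv : WithLp.toLp 2 v = 0
    · have : v = 0 := by simpa using hv
      simp [this]
    · set w : EuclideanSpace ℂ (Fin d) := WithLp.toLp 2 v
      have hu := hunit ((‖w‖⁻¹ : ℂ) • w) (norm_smul_inv_norm hv)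
      have he : Matrix.vecMulVec v (star v) = ((‖w‖ : ℂ) * ‖w‖) •
          Matrix.vecMulVec ((‖w‖⁻¹ : ℂ) • w).ofLp (star ((‖w‖⁻¹ : ℂ) • w).ofLp) := by
        have hw : (‖w‖ : ℂ) ≠ 0 := by exact_mod_cast norm_ne_zero_iff.mpr hv
        ext p q
        simp only [Matrix.vecMulVec_apply, Pi.star_apply, smul_eq_mul, star_mul',
          Matrix.smul_apply, WithLp.ofLp_smul, Pi.smul_apply, star_inv₀, Complex.star_def,
          Complex.conj_ofReal]
        field_simp
        rfl
      rw [he, map_smul, map_smul, hu]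
  have hpol : ∀ v w : Fin d → ℂ, Matrix.vecMulVec v (star w) = (4⁻¹ : ℂ) •
      (Matrix.vecMulVec (v + w) (star (v + w)) - Matrix.vecMulVec (v - w) (star (v - w))
        + Complex.I • Matrix.vecMulVec (v + Complex.I • w) (star (v + Complex.I • w))
        - Complex.I • Matrix.vecMulVec (v - Complex.I • w) (star (v - Complex.I • w))) := by
    intro v w
    ext p q
    simp [Matrix.vecMulVec_apply]
    linear_combination (v p * (starRingEnd ℂ) (w q) / 2 - (starRingEnd ℂ) (v q) * w p / 2 ) * Complex.I_sq
  refine LinearMap.ext fun A => ?_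
  induction A using Matrix.induction_on' with
  | h_zero => simp
  | h_add p q hp hq => rw [map_add, map_add, hp, hq]
  | h_std_basis i j c =>
    have he : (Matrix.single i j c : Op (Fin d))
        = Matrix.vecMulVec (Pi.single i c) (star (Pi.single j 1)) := by
      ext p q
      simp [Matrix.vecMulVec_apply, Matrix.single_apply, Pi.single_apply]
      grind
    rw [he, hpol]
    simp only [map_smul, map_sub, map_add, hall]

end Sharp

/-! ### Marginals, and the passage from cloning to sequential measurements -/

section Marginals

variable {n m : Type} [Fintype n] [DecidableEq n] [Fintype m] [DecidableEq m]

theorem heisenberg_injective {Φ Ψ : Op n →ₗ[ℂ] Op m} (h : heisenberg Φ = heisenberg Ψ) :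
    Φ = Ψ := by
  refine LinearMap.ext fun ρ => ?_
  rw [Matrix.ext_iff_trace_mul_right]
  intro A
  rw [← trace_mul_heisenberg, ← trace_mul_heisenberg, h]

omit [DecidableEq n] in
theorem trace_partialTrace₂_mul (M : Op (n × m)) (A : Op n) :
    (partialTrace₂ M * A).trace = (M * (A ⊗ₖ (1 : Op m))).trace := by
  simp [Matrix.trace, Matrix.mul_apply, partialTrace₂, Fintype.sum_prod_type, Matrix.one_apply,
    Finset.sum_mul]
  exact Finset.sum_congr rfl fun _ _ => Finset.sum_comm

omit [DecidableEq m] in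
theorem trace_partialTrace₁_mul (M : Op (n × m)) (A : Op m) :
    (partialTrace₁ M * A).trace = (M * ((1 : Op n) ⊗ₖ A)).trace := by
  simp [Matrix.trace, Matrix.mul_apply, partialTrace₁, Fintype.sum_prod_type, Matrix.one_apply,
    Finset.sum_mul]
  refine Eq.trans (Finset.sum_congr rfl fun _ _ => Finset.sum_comm) Finset.sum_comm

theorem heisenberg_partialTrace₂ {l : Type} [Fintype l] [DecidableEq l]
    (Γ : Op l →ₗ[ℂ] Op (n × m)) (A : Op n) :
    heisenberg (partialTrace₂ ∘ₗ Γ) A = heisenberg Γ (A ⊗ₖ (1 : Op m)) :=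
  heisenberg_eq_of_forall_trace fun ρ => by
    rw [LinearMap.comp_apply, trace_partialTrace₂_mul, trace_mul_heisenberg]

theorem heisenberg_partialTrace₁ {l : Type} [Fintype l] [DecidableEq l]
    (Γ : Op l →ₗ[ℂ] Op (n × m)) (A : Op m) :
    heisenberg (partialTrace₁ ∘ₗ Γ) A = heisenberg Γ ((1 : Op n) ⊗ₖ A) :=
  heisenberg_eq_of_forall_trace fun ρ => by
    rw [LinearMap.comp_apply, trace_partialTrace₁_mul, trace_mul_heisenberg]

theorem sum_cloningMeter_right {X Y : Type} [Fintype X] [Fintype Y] (Γ : Op n →ₗ[ℂ] Op (n × n))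
    (M : X → Op n) {N : Y → Op n} (hN : ∑ y, N y = 1) (x : X) :
    ∑ y, cloningMeter Γ M N (x, y) = heisenberg (partialTrace₂ ∘ₗ Γ) (M x) := by
  simp only [cloningMeter]
  rw [heisenberg_partialTrace₂, ← map_sum, ← hN]
  congr 1
  ext ⟨p, p'⟩ ⟨q, q'⟩
  simp [Matrix.sum_apply, Finset.mul_sum]

theorem sum_cloningMeter_left {X Y : Type} [Fintype X] [Fintype Y] (Γ : Op n →ₗ[ℂ] Op (n × n))
    {M : X → Op n} (N : Y → Op n) (hM : ∑ x, M x = 1) (y : Y) :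
    ∑ x, cloningMeter Γ M N (x, y) = heisenberg (partialTrace₁ ∘ₗ Γ) (N y) := by
  simp only [cloningMeter]
  rw [heisenberg_partialTrace₁, ← map_sum, ← hM]
  congr 1
  ext ⟨p, p'⟩ ⟨q, q'⟩
  simp [Matrix.sum_apply, Finset.sum_mul]

theorem noisyMeter_sum {d : ℕ} (φ : ONB d) (s : ℝ) : ∑ x, noisyMeter φ s x = 1 := by
  simp only [← depolarizing_sharpMeter, ← map_sum, sharpMeter_sum]
  rw [depolarizing_apply, Matrix.trace_one, Fintype.card_fin]
  rcases Nat.eq_zero_or_pos d with rfl | hd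
  · exact Subsingleton.elim _ _
  have : (d : ℂ) ≠ 0 := by exact_mod_cast hd.ne'
  rw [smul_smul, ← add_smul]
  convert one_smul ℂ _
  push_cast
  field_simp
  ring

/-- Summing out one meter leaves the Heisenberg marginal of `Γ` on the other's effects. These
determine the marginal, and depolarizing maps are their own Heisenberg duals. -/
theorem mem_cloningTradeoff_iff {d : ℕ} {p : ℝ × ℝ} :
    p ∈ cloningTradeoff d ↔ CompatibleChannels (depolarizing d p.1) (depolarizing d p.2) := by
  constructor
  · rintro ⟨Γ, hΓ, h⟩
    refine ⟨Γ, hΓ, heisenberg_injective ?_, heisenberg_injective ?_⟩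
    · refine linearMap_ext_sharpMeter fun φ x => ?_
      rw [← sum_cloningMeter_right Γ (sharpMeter φ) (sharpMeter_sum φ), (h φ φ).2.1,
        heisenberg_depolarizing, depolarizing_sharpMeter]
    · refine linearMap_ext_sharpMeter fun φ x => ?_
      rw [← sum_cloningMeter_left Γ (sharpMeter φ) (sharpMeter_sum φ), (h φ φ).2.2,
        heisenberg_depolarizing, depolarizing_sharpMeter]
  · rintro ⟨Γ, hΓ, h₁, h₂⟩
    refine ⟨Γ, hΓ, fun φ ψ => ?_⟩
    have hr : ∀ x, ∑ y, cloningMeter Γ (sharpMeter φ) (sharpMeter ψ) (x, y)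
        = noisyMeter φ p.1 x := fun x => by
      rw [sum_cloningMeter_right Γ _ (sharpMeter_sum ψ), h₁, heisenberg_depolarizing,
        depolarizing_sharpMeter]
    refine ⟨⟨fun x => hΓ.1.heisenberg_nonneg ?_, ?_⟩, hr, fun y => ?_⟩
    · have h1 := sharpMeter_nonneg φ x.1
      have h2 := sharpMeter_nonneg ψ x.2
      rw [Matrix.nonneg_iff_posSemidef] at *
      exact h1.kronecker h2
    · rw [Fintype.sum_prod_type]
      simp only [hr, noisyMeter_sum]
    · rw [sum_cloningMeter_left Γ _ (sharpMeter_sum φ), h₂, heisenberg_depolarizing,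
        depolarizing_sharpMeter]

theorem mem_sequentialTradeoff_of_compatible {d : ℕ} {φ : ONB d} {s t : ℝ}
    (h : CompatibleMeterChannel (noisyMeter φ s) (depolarizing d t)) :
    (s, t) ∈ sequentialTradeoff φ := by
  obtain ⟨J, hJ, h₁, h₂⟩ := h
  refine ⟨J, hJ, fun ψ => ?_⟩
  have hr : ∀ x, ∑ y, sequentialMeter J (sharpMeter ψ) (x, y) = noisyMeter φ s x := fun x => by
    simp only [sequentialMeter]
    rw [← map_sum, sharpMeter_sum, h₁]
  refine ⟨⟨fun x => (hJ.1 x.1).heisenberg_nonneg (sharpMeter_nonneg ψ _), ?_⟩, hr, fun y => ?_⟩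
  · rw [Fintype.sum_prod_type]
    simp only [hr, noisyMeter_sum]
  · rw [← depolarizing_sharpMeter, ← heisenberg_depolarizing, ← h₂]
    refine (heisenberg_eq_of_forall_trace fun ρ => ?_).symm
    simp only [sequentialMeter]
    rw [LinearMap.sum_apply, Finset.sum_mul, Finset.mul_sum, Matrix.trace_sum, Matrix.trace_sum]
    exact Finset.sum_congr rfl fun x _ => (trace_mul_heisenberg _ _ _).symm

/-- The operator `⟨u| ⊗ 𝟙`. -/
def braTensorOne (m : Type) [DecidableEq m] (u : n → ℂ) : Matrix m (n × m) ℂ :=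
  Matrix.of fun q p => if q = p.2 then star (u p.1) else 0

omit [DecidableEq n] in
theorem trace_conjMap_braTensorOne_mul (u : n → ℂ) (M : Op (n × m)) (A : Op m) :
    (conjMap (braTensorOne m u) M * A).trace
      = (M * (Matrix.vecMulVec u (star u) ⊗ₖ A)).trace := by
  have h : (braTensorOne m u)ᴴ * A * braTensorOne m u = Matrix.vecMulVec u (star u) ⊗ₖ A := by
    ext ⟨p, p'⟩ ⟨q, q'⟩
    simp [Matrix.mul_apply, braTensorOne, Matrix.vecMulVec_apply, apply_ite]
    ring
  rw [← h, conjMap_apply, Matrix.mul_assoc, Matrix.mul_assoc, Matrix.trace_mul_comm]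
  simp only [Matrix.mul_assoc]

theorem isChannel_of_comp_partialTrace₁ {Γ : Op n →ₗ[ℂ] Op (n × m)} {Φ : Op n →ₗ[ℂ] Op m}
    (hΓ : IsChannel Γ) (hΦ : IsCP Φ) (h : partialTrace₁ ∘ₗ Γ = Φ) : IsChannel Φ := by
  refine ⟨hΦ, fun ρ hρ => ?_⟩
  rw [← h, ← hΓ.2 ρ hρ, LinearMap.comp_apply, ← Matrix.mul_one (partialTrace₁ _),
    trace_partialTrace₁_mul, Matrix.one_kronecker_one, Matrix.mul_one]

/-- The instrument measures `Q` on the first output of the joint channel and keeps the second. -/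
theorem compatible_of_compatibleChannels {d : ℕ} (φ : ONB d) {s t : ℝ}
    (h : CompatibleChannels (depolarizing d s) (depolarizing d t)) :
    CompatibleMeterChannel (noisyMeter φ s) (depolarizing d t) := by
  obtain ⟨Γ, hΓ, h₁, h₂⟩ := h
  let J : Fin d → Op (Fin d) →ₗ[ℂ] Op (Fin d) := fun x =>
    conjMap (braTensorOne (Fin d) (φ x).ofLp) ∘ₗ Γ
  have hJ : ∀ x, IsCP (J x) := fun x => (isCP_conjMap _).comp hΓ.1
  have htr : ∀ x ρ A, (J x ρ * A).trace = (Γ ρ * (sharpMeter φ x ⊗ₖ A)).trace := fun x ρ A =>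
    trace_conjMap_braTensorOne_mul _ _ _
  have hsum : ∑ x, J x = depolarizing d t := by
    rw [← h₂]
    refine LinearMap.ext fun ρ => ?_
    rw [Matrix.ext_iff_trace_mul_right]
    intro A
    rw [LinearMap.comp_apply, trace_partialTrace₁_mul, LinearMap.sum_apply, Finset.sum_mul,
      Matrix.trace_sum, ← sharpMeter_sum φ]
    simp only [htr]
    rw [← Matrix.trace_sum, ← Finset.mul_sum]
    congr 2
    ext ⟨p, p'⟩ ⟨q, q'⟩
    simp [Matrix.sum_apply, Finset.sum_mul]
  refine ⟨J, ⟨hJ, isChannel_of_comp_partialTrace₁ hΓ (.sum _ fun x _ => hJ x)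
    (h₂.trans hsum.symm)⟩, fun x => ?_, hsum⟩
  refine heisenberg_eq_of_forall_trace fun ρ => ?_
  rw [htr, ← trace_partialTrace₂_mul, ← LinearMap.comp_apply, h₁, ← trace_mul_heisenberg,
    heisenberg_depolarizing, depolarizing_sharpMeter]

end Marginals

/-! ### Upper bound on asymmetric cloning -/

section CloningBound

variable {d : ℕ}

/-- Expands the squared distance from `v` to a combination of `∑ᵢ eᵢ⊗eᵢ⊗eₖ` and `∑ᵢ eᵢ⊗eₖ⊗eᵢ`. These
vectors have squared norm `d`; two from different families have inner product `1` for equal `k` and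
`0` otherwise. -/
theorem sum_normSq_sub_delta (v : Fin d → Fin d → Fin d → ℂ) (α β : Fin d → ℂ) :
    (∑ i, ∑ p, ∑ q, Complex.normSq
      (v i p q - (if i = p then α q else 0) - (if i = q then β p else 0)) : ℂ) =
    (∑ i, ∑ p, ∑ q, (Complex.normSq (v i p q) : ℂ))
      - ∑ k, (star (α k) * (∑ i, v i i k) + α k * star (∑ i, v i i k)
        + star (β k) * (∑ i, v i k i) + β k * star (∑ i, v i k i))
      + ∑ k, (d * Complex.normSq (α k) + d * Complex.normSq (β k)
        + (star (α k) * β k + α k * star (β k))) := by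
  have hexp : ∀ i p q, (Complex.normSq
      (v i p q - (if i = p then α q else 0) - (if i = q then β p else 0)) : ℂ) =
      (Complex.normSq (v i p q) : ℂ)
      - (if i = p then star (α q) * v i p q + α q * star (v i p q) else 0)
      - (if i = q then star (β p) * v i p q + β p * star (v i p q) else 0)
      + (if i = p then (Complex.normSq (α q) : ℂ) else 0)
      + (if i = q then (Complex.normSq (β p) : ℂ) else 0)
      + (if i = p then (if i = q then star (α q) * β p + α q * star (β p) else 0) else 0) := by
    intro i p q
    simp only [Complex.normSq_eq_conj_mul_self, Complex.star_def]
    split_ifs <;> simp <;> ring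
  have hp : ∀ F : Fin d → Fin d → Fin d → ℂ,
      ∑ i, ∑ p, ∑ q, (if i = p then F i p q else 0) = ∑ q, ∑ i, F i i q := fun F => by
    rw [Finset.sum_comm (f := fun q i => F i i q)]
    refine Finset.sum_congr rfl fun i _ => ?_
    rw [Finset.sum_comm]
    simp
  have hq : ∀ F : Fin d → Fin d → Fin d → ℂ,
      ∑ i, ∑ p, ∑ q, (if i = q then F i p q else 0) = ∑ p, ∑ i, F i p i := fun F => by
    rw [Finset.sum_comm]
    simp
  simp only [hexp, Finset.sum_add_distrib, Finset.sum_sub_distrib, hp, hq, Finset.sum_ite_eq',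
    Finset.mem_univ, if_true, Finset.sum_const, Finset.card_univ, Fintype.card_fin, nsmul_eq_mul,
    Finset.mul_sum, star_sum]
  ring

theorem sum_comm_reverse {A B C : Type} [Fintype A] [Fintype B] [Fintype C]
    (F : A → B → C → ℂ) : ∑ a, ∑ b, ∑ c, F a b c = ∑ c, ∑ b, ∑ a, F a b c := by
  rw [Finset.sum_comm]
  exact (Finset.sum_congr rfl fun b _ => Finset.sum_comm).trans Finset.sum_comm

theorem sum_comm_rotate {A B C : Type} [Fintype A] [Fintype B] [Fintype C]
    (F : A → B → C → C → ℂ) :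
    ∑ a, ∑ b, ∑ i, ∑ j, F a b i j = ∑ i, ∑ j, ∑ b, ∑ a, F a b i j := by
  calc _ = ∑ a, ∑ i, ∑ b, ∑ j, F a b i j := Finset.sum_congr rfl fun a _ => Finset.sum_comm
    _ = ∑ i, ∑ a, ∑ b, ∑ j, F a b i j := Finset.sum_comm
    _ = _ := Finset.sum_congr rfl fun i _ => sum_comm_reverse _

/-- Bessel's inequality for the span of those two families, with the cross term split by Young's
inequality of weight `c`. -/
theorem projection_inequality (hd : 2 ≤ d) (v : Fin d → Fin d → Fin d → ℂ) {c : ℝ} (hc : 0 < c) :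
    (d - c) * (∑ k, Complex.normSq (∑ i, v i i k))
      + (d - 1 / c) * (∑ k, Complex.normSq (∑ i, v i k i))
      ≤ ((d : ℝ) ^ 2 - 1) * ∑ i, ∑ p, ∑ q, Complex.normSq (v i p q) := by
  set f : Fin d → ℂ := fun k => ∑ i, v i i k
  set g : Fin d → ℂ := fun k => ∑ i, v i k i
  have hd' : (2 : ℝ) ≤ d := by exact_mod_cast hd
  obtain ⟨D, hDdef⟩ : ∃ D : ℝ, D = (d : ℝ) ^ 2 - 1 := ⟨_, rfl⟩
  rw [← hDdef]
  have hD : 0 < D := by nlinarith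
  have hDc : (D : ℂ) ≠ 0 := by exact_mod_cast hD.ne'
  -- Coefficients of the orthogonal projection: the inverse of the Gram matrix `[[d, 1], [1, d]]`,
  -- of determinant `D`, applied to `(f k, g k)`.
  let α : Fin d → ℂ := fun k => (d * f k - g k) / D
  let β : Fin d → ℂ := fun k => (d * g k - f k) / D
  have key := sum_normSq_sub_delta v α β
  have hpos : 0 ≤ ∑ i, ∑ p, ∑ q, Complex.normSq
      (v i p q - (if i = p then α q else 0) - (if i = q then β p else 0)) :=
    Finset.sum_nonneg fun _ _ => Finset.sum_nonneg fun _ _ => Finset.sum_nonneg fun _ _ =>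
      Complex.normSq_nonneg _
  set R : ℝ := ∑ i, ∑ p, ∑ q, Complex.normSq
      (v i p q - (if i = p then α q else 0) - (if i = q then β p else 0)) with hR
  set T : ℝ := ∑ i, ∑ p, ∑ q, Complex.normSq (v i p q) with hT
  have hres : D * R = D * T - ∑ k, (d * Complex.normSq (f k) + d * Complex.normSq (g k)
      - 2 * (star (f k) * g k).re) := by
    have hk : ∀ k, (D : ℂ) * ((star (α k) * f k + α k * star (f k)
        + star (β k) * g k + β k * star (g k))
        - (d * Complex.normSq (α k) + d * Complex.normSq (β k)
        + (star (α k) * β k + α k * star (β k)))) =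
        ((d * Complex.normSq (f k) + d * Complex.normSq (g k) - 2 * (star (f k) * g k).re : ℝ) : ℂ)
        := by
      intro k
      have h2 : ((2 * (star (f k) * g k).re : ℝ) : ℂ) = star (f k) * g k + f k * star (g k) := by
        apply Complex.ext <;> simp <;> ring
      have hdD : (d : ℂ) ^ 2 = D + 1 := by rw [hDdef]; push_cast; ring
      rw [Complex.ofReal_sub, h2]
      push_cast
      simp only [Complex.normSq_eq_conj_mul_self, Complex.star_def]
      simp only [α, β, map_div₀, map_sub, map_mul, Complex.conj_ofReal, Complex.conj_natCast]
      field_simp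
      linear_combination (-(d * ((starRingEnd ℂ) (f k) * f k + (starRingEnd ℂ) (g k) * g k)
        - ((starRingEnd ℂ) (f k) * g k + f k * (starRingEnd ℂ) (g k)))) * hdD
    have : ((D * R : ℝ) : ℂ) = ((D * T - ∑ k, (d * Complex.normSq (f k)
        + d * Complex.normSq (g k) - 2 * (star (f k) * g k).re) : ℝ) : ℂ) := by
      rw [Complex.ofReal_sub, Complex.ofReal_sum]
      simp only [← hk]
      rw [← Finset.mul_sum, Finset.sum_sub_distrib, hR, hT]
      push_cast
      rw [key]
      ring
    exact_mod_cast this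
  have hyoung : ∀ k, 2 * (star (f k) * g k).re
      ≤ c * Complex.normSq (f k) + 1 / c * Complex.normSq (g k) := by
    intro k
    have h0 := Complex.normSq_nonneg ((c : ℂ) * f k - g k)
    have h1 : Complex.normSq ((c : ℂ) * f k - g k) = c * (c * Complex.normSq (f k)
        + 1 / c * Complex.normSq (g k) - 2 * (star (f k) * g k).re) := by
      field_simp
      simp [Complex.normSq_apply]
      ring
    rw [h1] at h0
    linarith [nonneg_of_mul_nonneg_right h0 hc]
  have hy := Finset.sum_le_sum fun k (_ : k ∈ Finset.univ) => hyoung k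
  simp only [Finset.sum_add_distrib, Finset.sum_sub_distrib, ← Finset.mul_sum] at hres hy
  have := mul_nonneg hD.le hpos
  linarith

theorem single_diag_isState {n : Type} [Fintype n] [DecidableEq n] (i : n) :
    IsState (Matrix.single i i 1 : Op n) := by
  refine ⟨?_, by simp⟩
  rw [Matrix.nonneg_iff_posSemidef]
  have : (Matrix.single i i 1 : Op n) = Matrix.vecMulVec (Pi.single i 1) (star (Pi.single i 1)) := by
    ext p q
    simp [Matrix.vecMulVec_apply, Matrix.single_apply, Pi.single_apply]
    grind
  rw [this]
  exact Matrix.posSemidef_vecMulVec_self_star _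

/-- This is `d²` times the entanglement fidelity, the only feature of each marginal that the cloning
bound uses. -/
theorem sum_depolarizing_single (hd : 0 < d) (s : ℝ) :
    ∑ i, ∑ j, depolarizing d s (Matrix.single i j 1) i j = ((1 + ((d : ℝ) ^ 2 - 1) * s : ℝ) : ℂ) := by
  have hd' : (d : ℂ) ≠ 0 := by exact_mod_cast hd.ne'
  have h : ∀ i j : Fin d, depolarizing d s (Matrix.single i j 1) i j
      = s + if i = j then (((1 - s) / d : ℝ) : ℂ) else 0 := by
    intro i j
    rw [depolarizing_apply]
    by_cases hij : i = j
    · subst hij; simp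
    · simp [hij]
  simp only [h, Finset.sum_add_distrib, Finset.sum_ite_eq, Finset.mem_univ, if_true,
    Finset.sum_const, Finset.card_univ, Fintype.card_fin, nsmul_eq_mul]
  push_cast
  field_simp
  ring

/-- The supporting-line form of the optimal asymmetric cloning trade-off. -/
theorem CompatibleChannels.tradeoff (hd : 2 ≤ d) {s t : ℝ}
    (h : CompatibleChannels (depolarizing d s) (depolarizing d t)) {c : ℝ} (hc : 0 < c) :
    (d - c) * (1 + ((d : ℝ) ^ 2 - 1) * s) + (d - 1 / c) * (1 + ((d : ℝ) ^ 2 - 1) * t)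
      ≤ ((d : ℝ) ^ 2 - 1) * d := by
  obtain ⟨Γ, hΓ, h₁, h₂⟩ := h
  obtain ⟨ι, _, V, hV⟩ := hΓ.1.hasKraus
  have hent : ∀ i j a b, Γ (Matrix.single i j 1) a b = ∑ e, V e a i * star (V e b j) := by
    intro i j a b
    rw [hV, Matrix.sum_apply]
    refine Finset.sum_congr rfl fun e _ => ?_
    simp [Matrix.mul_apply, Matrix.single_apply, ite_and]
  have hD₁ : ∑ e, ∑ k, Complex.normSq (∑ i, V e (i, k) i) = 1 + ((d : ℝ) ^ 2 - 1) * s := by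
    have := sum_depolarizing_single (by omega : 0 < d) s
    rw [← h₁] at this
    simp only [LinearMap.comp_apply, partialTrace₂, LinearMap.coe_mk, AddHom.coe_mk,
      Matrix.of_apply, hent] at this
    apply Complex.ofReal_injective
    rw [← this]
    push_cast
    simp only [← Complex.mul_conj, map_sum, Finset.sum_mul_sum, Complex.star_def]
    exact sum_comm_rotate _
  have hD₂ : ∑ e, ∑ k, Complex.normSq (∑ i, V e (k, i) i) = 1 + ((d : ℝ) ^ 2 - 1) * t := by
    have := sum_depolarizing_single (by omega : 0 < d) t
    rw [← h₂] at this
    simp only [LinearMap.comp_apply, partialTrace₁, LinearMap.coe_mk, AddHom.coe_mk,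
      Matrix.of_apply, hent] at this
    apply Complex.ofReal_injective
    rw [← this]
    push_cast
    simp only [← Complex.mul_conj, map_sum, Finset.sum_mul_sum, Complex.star_def]
    exact sum_comm_rotate _
  have hT : ∑ e, ∑ i, ∑ p, ∑ q, Complex.normSq (V e (p, q) i) = d := by
    have htr : ∀ i, (Γ (Matrix.single i i 1)).trace = 1 := fun i => hΓ.2 _ (single_diag_isState i)
    have := Finset.sum_congr (rfl : (Finset.univ : Finset (Fin d)) = _) fun i _ => htr i
    simp only [Matrix.trace, Matrix.diag_apply, hent, Fintype.sum_prod_type, Finset.sum_const,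
      Finset.card_univ, Fintype.card_fin, nsmul_eq_mul, mul_one] at this
    apply Complex.ofReal_injective
    push_cast
    rw [← this]
    simp only [← Complex.mul_conj, Complex.star_def]
    rw [Finset.sum_comm]
    refine Finset.sum_congr rfl fun i _ => ?_
    rw [Finset.sum_comm]
    exact Finset.sum_congr rfl fun p _ => Finset.sum_comm
  have hsum := Finset.sum_le_sum fun e (_ : e ∈ Finset.univ) =>
    projection_inequality hd (fun i p q => V e (p, q) i) hc
  simp only [Finset.sum_add_distrib, ← Finset.mul_sum, hD₁, hD₂, hT] at hsum
  exact hsum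

end CloningBound

/-! ### The coherent exclusion instrument -/

section Instrument

variable {d : ℕ}

theorem depolarizing_trace (hd : 0 < d) (t : ℝ) (ρ : Op (Fin d)) :
    (depolarizing d t ρ).trace = ρ.trace := by
  have : (d : ℂ) ≠ 0 := by exact_mod_cast hd.ne'
  rw [depolarizing_apply]
  simp
  field_simp
  ring

/-- The terms `a 𝟙 - b Q(x)` sum to `(d a² - 2ab) ρ + b² ∑ᵢ tr(Q(i) ρ) Q(i)`. Extra noise replaces
the last sum by `b² tr(ρ) 𝟙`, which makes the total depolarizing. -/
theorem compatible_of_coherent_exclusion (hd : 2 ≤ d) (φ : ONB d) {a b : ℝ}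
    (hab : d * a ^ 2 - 2 * a * b + d * b ^ 2 = 1) :
    CompatibleMeterChannel (noisyMeter φ (-(2 * a * b))) (depolarizing d (1 - d * b ^ 2)) := by
  have hd' : (2 : ℝ) ≤ d := by exact_mod_cast hd
  have hdc : (d : ℂ) ≠ 0 := by exact_mod_cast (by omega : d ≠ 0)
  have hd1 : (d : ℂ) - 1 ≠ 0 := by
    have : ((d : ℝ) - 1 : ℝ) ≠ 0 := by linarith
    exact_mod_cast this
  let Q := sharpMeter φ
  let K : Fin d → Op (Fin d) := fun x => (a : ℂ) • 1 - (b : ℂ) • Q x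
  -- The second term sends `φᵢ` to the other basis states. Each `i` occurs for `d - 1` outcomes `x ≠
  -- i`, whence the weight; omitting `i = x` makes the total `b²` contribution to the effect a
  -- multiple of `𝟙`.
  let J : Fin d → Op (Fin d) →ₗ[ℂ] Op (Fin d) := fun x => conjMap (K x) +
    ((b ^ 2 / (d - 1) : ℝ) : ℂ) • ∑ i ∈ Finset.univ.erase x, ∑ j ∈ Finset.univ.erase i,
      conjMap (Matrix.vecMulVec (φ j).ofLp (star (φ i).ofLp))
  have hJcp : ∀ x, IsCP (J x) := fun x => (isCP_conjMap _).add <|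
    (IsCP.sum _ fun i _ => IsCP.sum _ fun j _ => isCP_conjMap _).smul
      (div_nonneg (sq_nonneg b) (by linarith))
  have hflip : ∀ i j ρ, conjMap (Matrix.vecMulVec (φ j).ofLp (star (φ i).ofLp)) ρ
      = (Q i * ρ).trace • Q j := fun i j ρ => by
    rw [conjMap_apply, Matrix.conjTranspose_vecMulVec, star_star, vecMulVec_mul_mul_vecMulVec]
    rfl
  have hQQ : ∀ x ρ, Q x * ρ * Q x = (Q x * ρ).trace • Q x := fun x ρ =>
    vecMulVec_mul_mul_vecMulVec _ _ _ _ _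
  have hQsum : ∑ x, Q x = 1 := sharpMeter_sum φ
  have hK : ∀ x ρ, conjMap (K x) ρ = ((a : ℂ) ^ 2) • ρ - ((a : ℂ) * b) • (Q x * ρ)
      - ((a : ℂ) * b) • (ρ * Q x) + ((b : ℂ) ^ 2 * (Q x * ρ).trace) • Q x := fun x ρ => by
    have hH : (K x)ᴴ = K x := by
      simp only [K, Matrix.conjTranspose_sub, Matrix.conjTranspose_smul, Matrix.conjTranspose_one,
        Complex.star_def, Complex.conj_ofReal, Q, sharpMeter_conjTranspose]
    rw [conjMap_apply, hH, mul_smul ((b : ℂ) ^ 2), ← hQQ]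
    simp only [K, sub_mul, mul_sub, Matrix.smul_mul, Matrix.mul_smul, one_mul, mul_one, smul_smul]
    module
  have hJ : ∀ x ρ, J x ρ = ((a : ℂ) ^ 2) • ρ - ((a : ℂ) * b) • (Q x * ρ)
      - ((a : ℂ) * b) • (ρ * Q x) + ((b : ℂ) ^ 2 * (Q x * ρ).trace) • Q x
      + ((b : ℂ) ^ 2 / (d - 1)) • (∑ i, (Q i * ρ).trace • (1 - Q i)
        - (Q x * ρ).trace • (1 - Q x)) := fun x ρ => by
    simp only [J, LinearMap.add_apply, LinearMap.smul_apply, LinearMap.sum_apply, hK, hflip]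
    simp only [← Finset.smul_sum, Finset.sum_erase_eq_sub (Finset.mem_univ _), hQsum]
    push_cast
    simp only [smul_sub]
  have htrQ : ∀ ρ, ∑ i, (Q i * ρ).trace = ρ.trace := fun ρ => by
    rw [← Matrix.trace_sum, ← Finset.sum_mul, hQsum, one_mul]
  have hsum : ∑ x, J x = depolarizing d (1 - d * b ^ 2) := by
    refine LinearMap.ext fun ρ => ?_
    have e1 : ∑ x, Q x * ρ = ρ := by rw [← Finset.sum_mul, hQsum, one_mul]
    have e2 : ∑ x, ρ * Q x = ρ := by rw [← Finset.mul_sum, hQsum, mul_one]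
    have e3 : ∑ i, (Q i * ρ).trace • (1 - Q i) = ρ.trace • 1 - ∑ i, (Q i * ρ).trace • Q i := by
      simp only [smul_sub, Finset.sum_sub_distrib, ← Finset.sum_smul, htrQ]
    have habc : (d : ℂ) * a ^ 2 - 2 * a * b + d * b ^ 2 = 1 := by exact_mod_cast hab
    rw [LinearMap.sum_apply, depolarizing_apply]
    simp only [hJ, Finset.sum_add_distrib, Finset.sum_sub_distrib, ← Finset.smul_sum, e1, e2, e3,
      mul_smul, Finset.sum_const, Finset.card_univ, Fintype.card_fin]
    push_cast
    have h1 : (1 : ℂ) - d * b ^ 2 = d * a ^ 2 - 2 * a * b := by linear_combination -habc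
    have h2 : (1 - (1 - (d : ℂ) * b ^ 2)) / d = b ^ 2 := by field_simp; ring
    rw [h2, h1]
    match_scalars <;> field_simp <;> ring
  refine ⟨J, ⟨hJcp, .sum _ fun x _ => hJcp x, fun ρ hρ => ?_⟩, fun x => ?_, hsum⟩
  · rw [hsum, depolarizing_trace (by omega), hρ.2]
  · refine heisenberg_eq_of_forall_trace fun ρ => ?_
    have hQ1 : ∀ i, (Q i).trace = 1 := sharpMeter_trace φ
    have h1 : (1 - (-(2 * a * b))) / d = a ^ 2 + b ^ 2 := by
      field_simp
      linarith
    rw [mul_one, hJ, noisyMeter, h1, mul_add, Matrix.mul_smul, Matrix.mul_smul, mul_one]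
    simp only [Matrix.trace_add, Matrix.trace_sub, Matrix.trace_smul, Matrix.trace_sum, hQ1,
      Matrix.trace_one, Fintype.card_fin, smul_eq_mul, ← Finset.sum_mul, htrQ,
      Matrix.trace_mul_comm ρ, Q]
    push_cast
    field_simp
    ring

end Instrument

/-! ### Advantage for negative noise parameters, and the conclusion -/

theorem exists_advantage {d : ℕ} (hd : 2 ≤ d) (φ : ONB d) {s : ℝ} (hs : s ∈ Set.Ico (m₂ d) 0) :
    ∃ t ∈ Set.Ioo (0 : ℝ) 1, CompatibleMeterChannel (noisyMeter φ s) (depolarizing d t) ∧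
      ¬ CompatibleChannels (depolarizing d s) (depolarizing d t) := by
  have hd' : (2 : ℝ) ≤ d := by exact_mod_cast hd
  obtain ⟨hs1, hs0⟩ := hs
  have hD : (0 : ℝ) < (d : ℝ) ^ 2 - 1 := by nlinarith
  have hs2 : 0 ≤ 1 + ((d : ℝ) ^ 2 - 1) * s := by
    rw [m₂, div_le_iff₀ hD] at hs1
    linarith
  have hsm : -1 < s := by nlinarith
  -- The two equations say `(a ± b)² = (1 - s)/d ∓ s`; the square roots `P` and `R` are `a + b` and
  -- `a - b`.
  obtain ⟨a, b, hb, hba, hab, hab2⟩ : ∃ a b : ℝ, 0 < b ∧ b ≤ a ∧ 2 * a * b = -s ∧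
      d * (a ^ 2 + b ^ 2) = 1 - s := by
    have hq : 0 ≤ (1 - s) / d + s := by
      have : (1 - s) / d + s = (1 + (d - 1) * s) / d := by field_simp; ring
      rw [this]
      refine div_nonneg ?_ (by linarith)
      nlinarith
    have hp : (1 - s) / d + s < (1 - s) / d - s := by linarith
    have hsq := Real.sqrt_lt_sqrt hq hp
    have hqs := Real.mul_self_sqrt hq
    have hps := Real.mul_self_sqrt (hq.trans hp.le)
    have hq0 := Real.sqrt_nonneg ((1 - s) / d + s)
    set P := Real.sqrt ((1 - s) / d - s)
    set R := Real.sqrt ((1 - s) / d + s)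
    refine ⟨(P + R) / 2, (P - R) / 2, by linarith, by linarith, by linarith, ?_⟩
    have : ((P + R) / 2) ^ 2 + ((P - R) / 2) ^ 2 = (1 - s) / d := by linarith
    rw [this]
    field_simp
  have hnorm : d * a ^ 2 - 2 * a * b + d * b ^ 2 = 1 := by linarith
  have hcompat := compatible_of_coherent_exclusion hd φ hnorm
  rw [hab, neg_neg] at hcompat
  refine ⟨1 - d * b ^ 2, ⟨?_, ?_⟩, hcompat, fun h => ?_⟩
  -- Hence `d b² ≤ (1 - s)/2 < 1`, since `s > -1`.
  · have : b ^ 2 ≤ a ^ 2 := by nlinarith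
    nlinarith
  · have : 0 < d * b ^ 2 := by positivity
    linarith
  · have hD₁ : 1 + ((d : ℝ) ^ 2 - 1) * s = d * ((a - d * b) ^ 2 - (d ^ 2 - 1) * b ^ 2) := by
      have : s = -(2 * a * b) := by linarith
      rw [this]
      linear_combination (-1 : ℝ) * hnorm
    -- Otherwise `0 ≤ d b - a ≤ (d - 1) b`, so `(a - d b)² < (d² - 1) b²`, contradicting the
    -- nonnegative fidelity of `I_s`.
    have hadb : d * b < a := by
      by_contra! hle
      have h1 : 0 ≤ (a - d * b) ^ 2 - (d ^ 2 - 1) * b ^ 2 := by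
        rw [hD₁] at hs2
        exact nonneg_of_mul_nonneg_right hs2 (by linarith)
      nlinarith [mul_pos hb hb]
    have hX : 0 < a - d * b := by linarith
    have hY : 0 < d * a - b := by nlinarith
    have hD₂ : 1 + ((d : ℝ) ^ 2 - 1) * (1 - d * b ^ 2) = d * (d * a - b) ^ 2 := by
      linear_combination (-(d : ℝ) ^ 2) * hnorm
    -- With `c = Y/X` the bound would be an equality if the fidelity term of `s` were `d X²`. The
    -- actual term is smaller and its coefficient `d - c` is negative, so the bound fails.
    have hT := h.tradeoff hd (div_pos hY hX)
    rw [hD₁, hD₂, one_div_div] at hT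
    set X := a - d * b with hXdef
    set Y := d * a - b with hYdef
    have hcoef : (d : ℝ) - Y / X < 0 := by
      rw [sub_neg, lt_div_iff₀ hX]
      nlinarith
    have hstrict : (d - Y / X) * (d * X ^ 2) <
        (d - Y / X) * (d * (X ^ 2 - (d ^ 2 - 1) * b ^ 2)) := by
      refine mul_lt_mul_of_neg_left ?_ hcoef
      have : 0 < d * ((d ^ 2 - 1) * b ^ 2) := by positivity
      linarith
    have heq : (d - Y / X) * (d * X ^ 2) + (d - X / Y) * (d * Y ^ 2)
        = ((d : ℝ) ^ 2 - 1) * d := by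
      have h1 : (d - Y / X) * (d * X ^ 2) = d * (d * X ^ 2 - X * Y) := by field_simp
      have h2 : (d - X / Y) * (d * Y ^ 2) = d * (d * Y ^ 2 - X * Y) := by field_simp
      rw [h1, h2, hXdef, hYdef]
      linear_combination (d * ((d : ℝ) ^ 2 - 1)) * hnorm
    linarith

end QuantumDevices

theorem mainTheorem5 (d : ℕ) (hd : 2 ≤ d) (φ : QuantumDevices.ONB d) :
    QuantumDevices.ecrII d ⊂ QuantumDevices.ecrQI φ ∧
    QuantumDevices.cloningTradeoff d ⊂ QuantumDevices.sequentialTradeoff φ ∧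
    ∀ s ∈ Set.Ico (QuantumDevices.m₂ d) 0, ∃ t ∈ Set.Ioo (0 : ℝ) 1,
      QuantumDevices.CompatibleMeterChannel (QuantumDevices.noisyMeter φ s)
        (QuantumDevices.depolarizing d t) ∧
      ¬ QuantumDevices.CompatibleChannels (QuantumDevices.depolarizing d s)
        (QuantumDevices.depolarizing d t) ∧
      (s, t) ∈ QuantumDevices.sequentialTradeoff φ ∧
      (s, t) ∉ QuantumDevices.cloningTradeoff d := by
  open QuantumDevices in
  have hd' : (2 : ℝ) ≤ d := by exact_mod_cast hd
  have hm₂ : m₂ d < 0 := div_neg_of_neg_of_pos (by norm_num) (by nlinarith)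
  have hm : m₁ d ≤ m₂ d := by
    rw [m₁, m₂, div_le_div_iff₀ (by linarith) (by nlinarith)]
    nlinarith
  have hsub : cloningTradeoff d ⊆ sequentialTradeoff φ := fun p hp =>
    mem_sequentialTradeoff_of_compatible
      (compatible_of_compatibleChannels φ (mem_cloningTradeoff_iff.mp hp))
  have hadv : ∀ s ∈ Set.Ico (m₂ d) 0, ∃ t ∈ Set.Ioo (0 : ℝ) 1,
      CompatibleMeterChannel (noisyMeter φ s) (depolarizing d t) ∧
      ¬ CompatibleChannels (depolarizing d s) (depolarizing d t) ∧
      (s, t) ∈ sequentialTradeoff φ ∧ (s, t) ∉ cloningTradeoff d := fun s hs => by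
    obtain ⟨t, ht, h₁, h₂⟩ := exists_advantage hd φ hs
    exact ⟨t, ht, h₁, h₂, mem_sequentialTradeoff_of_compatible h₁,
      fun h => h₂ (mem_cloningTradeoff_iff.mp h)⟩
  obtain ⟨t, ht, h₁, h₂, h₃, h₄⟩ := hadv (m₂ d) ⟨le_rfl, hm₂⟩
  refine ⟨(Set.ssubset_iff_of_subset ?_).mpr ⟨(m₂ d, t), ?_, fun h => h₂ h.2.2⟩,
    (Set.ssubset_iff_of_subset hsub).mpr ⟨_, h₃, h₄⟩, hadv⟩
  · exact fun p hp => ⟨⟨hm.trans hp.1.1, hp.1.2⟩, hp.2.1,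
      compatible_of_compatibleChannels φ hp.2.2⟩
  · exact ⟨⟨hm, by linarith⟩, ⟨by linarith [ht.1], ht.2.le⟩, h₁⟩
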